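/- Let $g\ge 0$, let $D\in\mathbb{C}[x]$ be a monic polynomial of degree $2g+2$ with distinct roots, and let $r\ge 0$ be an integer. Let $C$ be the smooth completion of the affine curve $y^2=D(x)$, obtained by gluing $U_0: y^2=D(x)$ and $U_\infty: v^2=u^{2g+2}D(1/u)$ along $\{x\ne0\}$ and $\{u\ne 0\}$ through $(u,v)=(1/x,\,y/x^{g+1})$; let $\infty_+$ and $\infty_-$ be the points $(u,v)=(0,1)$ and $(0,-1)$ of $U_\infty$. The following claims are equivalent: 1. There are polynomials $P,Q\in\mathbb{C}[x]$ and a constant $c\in\mathbb{C}\setminus\{0\}$ such that $P^2-DQ^2=c$ and $\deg P=r$. 2. The divisor $r\big((\infty_-)-(\infty_+)\big)$ on $C$ is linearly equivalent to $0$, i.e. it is the divisor $\operatorname{div}(f)=\sum_{p\in C}\operatorname{ord}_p(f)\,p$ of some nonzero rational function $f\in\operatorname{Frac}\big(\mathbb{C}[x,y]/(y^2-D(x))\big)$ on $C$. -/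

import Mathlib

open Polynomial Filter Topology
open scoped Polynomial.Bivariate

/-- The data of a hyperelliptic curve `y ^ 2 = D(x)` over `ℂ`: a monic polynomial `D` of degree
`2 * g + 2` with distinct roots. -/
structure HyperellipticCurve where
  /-- the integer `g ≥ 0` -/
  g : ℕ
  /-- the right-hand side of the equation `y ^ 2 = D(x)` -/
  D : ℂ[X]
  monic : D.Monic
  natDegree_eq : D.natDegree = 2 * g + 2
  nodup_roots : D.roots.Nodup

/-- `γ` is a local holomorphic parametrization, at the point `p`, of the smooth affine curve
`w ^ 2 = E(z)` with coordinates `(z, w)`, i.e. the inverse of a holomorphic chart centred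
at `p`. -/
structure IsLocalParam (E : ℂ[X]) (p : ℂ × ℂ) (γ : ℂ → ℂ × ℂ) : Prop where
  analyticAt : AnalyticAt ℂ γ 0
  map_zero : γ 0 = p
  deriv_ne_zero : deriv γ 0 ≠ 0
  mem_curve : ∀ᶠ t in 𝓝 (0 : ℂ), (γ t).2 ^ 2 = E.eval (γ t).1

/-- A smooth point has a local parametrization. -/
theorem exists_isLocalParam (E : ℂ[X]) (a b : ℂ) (h : b ^ 2 = E.eval a)
    (hs : b ≠ 0 ∨ E.derivative.eval a ≠ 0) : ∃ γ, IsLocalParam E (a, b) γ := by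
  by_cases hb : b = 0
  · have hd : E.derivative.eval a ≠ 0 := hs.resolve_left (not_not.mpr hb)
    have hE : AnalyticAt ℂ (fun z => E.eval z) a := by
      simpa using AnalyticAt.aeval_polynomial (analyticAt_id (𝕜 := ℂ) (z := a)) E
    have hd' : deriv (fun z => E.eval z) a ≠ 0 := by rwa [Polynomial.deriv]
    have h0 : E.eval a = 0 := by rw [← h, hb]; norm_num
    set s : ℂ → ℂ := hE.hasStrictDerivAt.localInverse _ _ _ hd' with hsdef
    have hsan : AnalyticAt ℂ s 0 := by
      have := hE.analyticAt_localInverse hd'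
      rwa [h0] at this
    have hr : ∀ᶠ w in 𝓝 (0 : ℂ), E.eval (s w) = w := by
      have := hE.hasStrictDerivAt.eventually_right_inverse hd'
      simpa only [h0] using this
    have hs0 : s 0 = a := by
      have := HasStrictFDerivAt.localInverse_apply_image
        (hE.hasStrictDerivAt.hasStrictFDerivAt_equiv hd')
      simpa only [h0] using this
    have hsq : AnalyticAt ℂ (fun t : ℂ => t ^ 2) 0 := by fun_prop
    have han : AnalyticAt ℂ (fun t : ℂ => s (t ^ 2)) 0 :=
      AnalyticAt.fun_comp (by simpa using hsan) hsq
    refine ⟨fun t => (s (t ^ 2), t), AnalyticAt.prod han analyticAt_id, by simp [hs0, hb], ?_, ?_⟩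
    · rw [(han.differentiableAt.hasDerivAt.prodMk (hasDerivAt_id' (0 : ℂ))).deriv]
      simp
    · have ht : Tendsto (fun t : ℂ => t ^ 2) (𝓝 0) (𝓝 0) := by
        simpa using hsq.continuousAt.tendsto
      filter_upwards [ht.eventually hr] with t ht
      exact ht.symm
  · have hE : AnalyticAt ℂ (fun t => E.eval (a + t) / b ^ 2) 0 := by
      have : AnalyticAt ℂ (fun t : ℂ => a + t) 0 := by fun_prop
      simpa using (AnalyticAt.aeval_polynomial this E).div_const (c := b ^ 2)
    have h1 : E.eval (a + 0) / b ^ 2 = 1 := by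
      rw [add_zero, ← h]; exact div_self (pow_ne_zero 2 hb)
    have hlog : AnalyticAt ℂ (fun t => Complex.log (E.eval (a + t) / b ^ 2)) 0 :=
      hE.clog (by rw [h1]; exact Complex.one_mem_slitPlane)
    have hw : AnalyticAt ℂ
        (fun t => b * Complex.exp (Complex.log (E.eval (a + t) / b ^ 2) / 2)) 0 :=
      analyticAt_const.mul (hlog.div_const).cexp
    have hx : HasDerivAt (fun t : ℂ => a + t) 1 0 := (hasDerivAt_id (0 : ℂ)).const_add a
    refine ⟨fun t => (a + t, b * Complex.exp (Complex.log (E.eval (a + t) / b ^ 2) / 2)),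
      AnalyticAt.prod (by fun_prop) hw, ?_, ?_, ?_⟩
    · simp only [h1]; simp
    · rw [(hx.prodMk hw.differentiableAt.hasDerivAt).deriv]
      simp
    · have hne : ∀ᶠ t in 𝓝 (0 : ℂ), E.eval (a + t) / b ^ 2 ≠ 0 :=
        hE.continuousAt.eventually_ne (by rw [h1]; exact one_ne_zero)
      filter_upwards [hne] with t ht
      rw [mul_pow, ← Complex.exp_nat_mul, Nat.cast_ofNat, mul_div_cancel₀ _ two_ne_zero,
        Complex.exp_log ht, mul_div_cancel₀ _ (pow_ne_zero 2 hb)]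

namespace HyperellipticCurve

variable (C : HyperellipticCurve)

/-- The ring of regular functions `ℂ[X, Y] / (Y ^ 2 - D(X))` on the affine curve. -/
abbrev CoordRing : Type := AdjoinRoot ((X ^ 2 - Polynomial.C C.D : ℂ[X][Y]))

/-- The field of rational functions: the fractions of the ring of regular functions. It is also
the field of rational functions of the completed curve, of which the affine curve is a
dense open subset. -/
abbrev FunctionField : Type := FractionRing C.CoordRing

/-- The rational function `f` is the fraction `G / H`, with `G, H ∈ ℂ[X, Y]`. -/
def IsFraction (f : C.FunctionField) (G H : ℂ[X][Y]) : Prop :=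
  AdjoinRoot.mk _ H ∈ nonZeroDivisors C.CoordRing ∧
    f * algebraMap C.CoordRing C.FunctionField (AdjoinRoot.mk _ H) =
      algebraMap C.CoordRing C.FunctionField (AdjoinRoot.mk _ G)

open scoped Classical in
/-- The value of a rational function `f` at a point `(x, y)` of the affine curve: it is
`G(x, y) / H(x, y)` if `f = G / H` with `H(x, y) ≠ 0`, and `0` if `f` has no such expression
(that is, at the finitely many poles of `f`). -/
noncomputable def value (f : C.FunctionField) (x y : ℂ) : ℂ :=
  if h : ∃ GH : ℂ[X][Y] × ℂ[X][Y], C.IsFraction f GH.1 GH.2 ∧ GH.2.evalEval x y ≠ 0 then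
    h.choose.1.evalEval x y / h.choose.2.evalEval x y
  else 0

/-- The right-hand side `u ^ (2 * g + 2) * D(1 / u)` of the equation `v ^ 2 = u ^ (2 * g + 2) *
D(1 / u)` of the affine chart `U_∞` at infinity. -/
noncomputable def Dinf : ℂ[X] := C.D.reverse

/-- The points of the smooth completion, which is glued from `U_0 : y ^ 2 = D(x)` and
`U_∞ : v ^ 2 = u ^ (2 * g + 2) * D(1 / u)` along `x ≠ 0`, `u ≠ 0` by
`(u, v) = (1 / x, y / x ^ (g + 1))`. Since the points of `U_∞` with `u ≠ 0` are identified with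
points of `U_0`, a point is either a point `(x, y)` of `U_0` or a point `(0, v)` of `U_∞`. -/
inductive Point : Type
  | affine (x y : ℂ) (h : y ^ 2 = C.D.eval x) : Point
  | infinity (v : ℂ) (h : v ^ 2 = C.Dinf.eval 0) : Point

theorem eval_zero_Dinf : C.Dinf.eval 0 = 1 := by
  rw [Dinf, ← coeff_zero_eq_eval_zero, coeff_zero_reverse]
  exact C.monic

/-- The point `∞₊ = (0, 1)` of `U_∞`. -/
def inftyPlus : C.Point := .infinity 1 (by rw [C.eval_zero_Dinf]; norm_num)

/-- The point `∞₋ = (0, -1)` of `U_∞`. -/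
def inftyMinus : C.Point := .infinity (-1) (by rw [C.eval_zero_Dinf]; norm_num)

/-- Local holomorphic parametrizations of the completed curve at a point, in the coordinates
`(x, y)` of `U_0` at the affine points and `(u, v)` of `U_∞` at the points at infinity. -/
def IsParamAt : C.Point → (ℂ → ℂ × ℂ) → Prop
  | .affine x y _, γ => IsLocalParam C.D (x, y) γ
  | .infinity v _, γ => IsLocalParam C.Dinf (0, v) γ

/-- Each point of the completed curve has a local parametrization. -/
theorem exists_isParamAt (p : C.Point) : ∃ γ, C.IsParamAt p γ := by
  cases p with
  | affine x y h =>
    refine exists_isLocalParam C.D x y h ?_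
    by_contra! hc
    have hx : C.D.IsRoot x := by rw [IsRoot.def, ← h, hc.1]; norm_num
    have h1 := (one_lt_rootMultiplicity_iff_isRoot C.monic.ne_zero).2 ⟨hx, hc.2⟩
    have h2 := Multiset.nodup_iff_count_le_one.1 C.nodup_roots x
    rw [count_roots] at h2
    omega
  | infinity v h =>
    refine exists_isLocalParam C.Dinf 0 v h (Or.inl ?_)
    rintro rfl
    rw [C.eval_zero_Dinf] at h
    norm_num at h

/-- The rational function `f` read in a local parametrization `γ` at a point; at infinity one
uses `(x, y) = (1 / u, v / u ^ (g + 1))`. -/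
noncomputable def pullback (f : C.FunctionField) : C.Point → (ℂ → ℂ × ℂ) → ℂ → ℂ
  | .affine _ _ _, γ => fun t => C.value f (γ t).1 (γ t).2
  | .infinity _ _, γ => fun t => C.value f (1 / (γ t).1) ((γ t).2 / (γ t).1 ^ (C.g + 1))

/-- `ord_p(f) = n`: the rational function `f`, seen as a meromorphic function near the point `p`
of the completed curve, has order `n` at `p`. The order does not depend on the local holomorphic
coordinate; such a coordinate exists at each point by `exists_isParamAt`. -/
def HasOrder (f : C.FunctionField) (p : C.Point) (n : ℤ) : Prop :=
  ∀ γ : ℂ → ℂ × ℂ, C.IsParamAt p γ →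
    MeromorphicAt (C.pullback f p γ) 0 ∧ meromorphicOrderAt (C.pullback f p γ) 0 = (n : WithTop ℤ)

/-- Divisors on the completed curve. -/
abbrev Divisor : Type := C.Point →₀ ℤ

/-- `E` is the divisor `div(f) = ∑ ord_p(f) p` of some nonzero rational function `f`. -/
def IsPrincipal (E : C.Divisor) : Prop :=
  ∃ f : C.FunctionFieldˣ, ∀ p : C.Point, C.HasOrder (f : C.FunctionField) p (E p)

/-- Linear equivalence of divisors. -/
def LinearlyEquivalent (E₁ E₂ : C.Divisor) : Prop := C.IsPrincipal (E₁ - E₂)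

/-- The divisor `(∞₋) - (∞₊)`. -/
noncomputable def inftyDivisor : C.Divisor :=
  Finsupp.single C.inftyMinus 1 - Finsupp.single C.inftyPlus 1

/-- `(P, Q)` is a solution of the Pell-Abel equation `P ^ 2 - D * Q ^ 2 = c` for some nonzero
constant `c`. -/
def IsPellAbelSolution (P Q : ℂ[X]) : Prop :=
  ∃ c : ℂ, c ≠ 0 ∧ P ^ 2 - C.D * Q ^ 2 = Polynomial.C c

end HyperellipticCurve

/-! The link is `f = P(x) + y Q(x)`, whose product with its conjugate `P(x) - y Q(x)` is `P ^ 2 - D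
Q ^ 2`.

If this norm is a nonzero constant, `f` is a unit on the affine curve, so its divisor lives at
infinity. For nonconstant `P`, comparing top terms gives `deg P = deg Q + g + 1` and leading
coefficients equal up to sign. After a choice of the sign of `Q`, the top terms of `f` do not cancel
at `∞₊`, so `f` has a pole of order `deg P` there. The same holds for the conjugate at `∞₋`, and
constancy of the product turns that pole into a zero of `f` (`IsPellAbelSolution.order_atInfinity`).

Conversely, a function with this divisor has no affine zeros or poles. It is then regular, hence of
the form `P + y Q` (`exists_eq_regular_of_hasOrder`), and its norm is a polynomial without roots,
i.e. a nonzero constant. The degree of `P` is read from `2 P`, the sum of `f` and its conjugate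
(`IsPellAbelSolution.natDegree_eq_of_order`). -/

theorem Polynomial.analyticAt_eval_comp (P : ℂ[X]) {f : ℂ → ℂ} {z : ℂ} (hf : AnalyticAt ℂ f z) :
    AnalyticAt ℂ (fun t => P.eval (f t)) z := by
  simpa using AnalyticAt.aeval_polynomial hf P

theorem Polynomial.hasDerivAt_eval_comp (P : ℂ[X]) {f : ℂ → ℂ} {f' z : ℂ}
    (hf : HasDerivAt f f' z) :
    HasDerivAt (fun t => P.eval (f t)) (P.derivative.eval (f z) * f') z :=
  (P.hasDerivAt (f z)).comp z hf

theorem Polynomial.eval_reverse_eq (P : ℂ[X]) {u : ℂ} (hu : u ≠ 0) :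
    P.reverse.eval u = u ^ P.natDegree * P.eval (1 / u) := by
  let _ : Invertible u⁻¹ := invertibleOfNonzero (inv_ne_zero hu)
  have h := eval₂_reverse_mul_pow (RingHom.id ℂ) u⁻¹ P
  simp only [invOf_eq_inv, inv_inv, eval₂_id] at h
  rw [one_div, ← h, mul_comm, mul_assoc, ← mul_pow, inv_mul_cancel₀ hu, one_pow, mul_one]

/-! ### Local parametrizations of `w ^ 2 = E(z)` -/

namespace IsLocalParam

variable {E : ℂ[X]} {a b : ℂ} {γ : ℂ → ℂ × ℂ}

theorem analyticAt_fst (h : IsLocalParam E (a, b) γ) : AnalyticAt ℂ (fun t => (γ t).1) 0 :=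
  _root_.analyticAt_fst.comp h.analyticAt

theorem analyticAt_snd (h : IsLocalParam E (a, b) γ) : AnalyticAt ℂ (fun t => (γ t).2) 0 :=
  _root_.analyticAt_snd.comp h.analyticAt

theorem hasDerivAt_fst (h : IsLocalParam E (a, b) γ) :
    HasDerivAt (fun t => (γ t).1) (deriv (fun t => (γ t).1) 0) 0 :=
  h.analyticAt_fst.differentiableAt.hasDerivAt

theorem hasDerivAt_snd (h : IsLocalParam E (a, b) γ) :
    HasDerivAt (fun t => (γ t).2) (deriv (fun t => (γ t).2) 0) 0 :=
  h.analyticAt_snd.differentiableAt.hasDerivAt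

theorem fst_zero (h : IsLocalParam E (a, b) γ) : (γ 0).1 = a := by rw [h.map_zero]

theorem snd_zero (h : IsLocalParam E (a, b) γ) : (γ 0).2 = b := by rw [h.map_zero]

theorem deriv_fst_ne_zero_or (h : IsLocalParam E (a, b) γ) :
    deriv (fun t => (γ t).1) 0 ≠ 0 ∨ deriv (fun t => (γ t).2) 0 ≠ 0 := by
  by_contra! hc
  apply h.deriv_ne_zero
  have := (h.hasDerivAt_fst.prodMk h.hasDerivAt_snd).deriv
  rw [hc.1, hc.2] at this
  exact this

/-- Differentiate the equation of the curve along `γ`. Consequently `z` is a local coordinate where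
`b ≠ 0`, and `w` is one at the branch points. -/
theorem deriv_relation (h : IsLocalParam E (a, b) γ) :
    2 * b * deriv (fun t => (γ t).2) 0 = E.derivative.eval a * deriv (fun t => (γ t).1) 0 := by
  have h1 := h.hasDerivAt_snd.fun_pow 2
  have h2 := E.hasDerivAt_eval_comp h.hasDerivAt_fst
  rw [h.fst_zero] at h2
  have h3 := (h2.congr_of_eventuallyEq h.mem_curve).unique h1
  rw [h3, h.snd_zero]
  simp

theorem deriv_fst_ne_zero (h : IsLocalParam E (a, b) γ) (hb : b ≠ 0) :
    deriv (fun t => (γ t).1) 0 ≠ 0 := by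
  intro h0
  have h1 := h.deriv_relation
  rw [h0, mul_zero, mul_eq_zero] at h1
  rcases h.deriv_fst_ne_zero_or with h2 | h2
  · exact h2 h0
  · exact h1.elim (by simpa using hb) h2

theorem deriv_fst_eq_zero (h : IsLocalParam E (a, 0) γ) (hE : E.derivative.eval a ≠ 0) :
    deriv (fun t => (γ t).1) 0 = 0 := by
  have h1 := h.deriv_relation
  rw [mul_zero, zero_mul, eq_comm, mul_eq_zero] at h1
  exact h1.resolve_left hE

/-- Otherwise `z` would be constant near `0`; this forces `b = 0` and then `w ^ 2 = E(a) = 0`, so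
`γ` itself would be constant. -/
theorem eventually_fst_ne (h : IsLocalParam E (a, b) γ) :
    ∀ᶠ t in 𝓝[≠] (0 : ℂ), (γ t).1 ≠ a := by
  rcases (h.analyticAt_fst.sub (analyticAt_const (v := a))).eventually_eq_zero_or_eventually_ne_zero
    with h0 | h0
  · exfalso
    have hx : (fun t => (γ t).1) =ᶠ[𝓝 0] fun _ => a := by
      filter_upwards [h0] with t ht using sub_eq_zero.1 ht
    have hx' : deriv (fun t => (γ t).1) 0 = 0 := by rw [hx.deriv_eq, deriv_const]
    have hb : b = 0 := by
      by_contra hb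
      exact h.deriv_fst_ne_zero hb hx'
    have hE : E.eval a = 0 := by
      have := h.mem_curve.self_of_nhds
      rw [h.map_zero, hb] at this
      simpa using this.symm
    have hy : (fun t => (γ t).2) =ᶠ[𝓝 0] fun _ => 0 := by
      filter_upwards [hx, h.mem_curve] with t h1 h2
      rw [h1, hE] at h2
      exact pow_eq_zero_iff two_ne_zero |>.1 h2
    have hy' : deriv (fun t => (γ t).2) 0 = 0 := by rw [hy.deriv_eq, deriv_const]
    exact h.deriv_fst_ne_zero_or.elim (· hx') (· hy')
  · filter_upwards [h0] with t ht using sub_ne_zero.1 ht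

theorem eventually_eval_fst_ne_zero (h : IsLocalParam E (a, b) γ) {H : ℂ[X]} (hH : H ≠ 0) :
    ∀ᶠ t in 𝓝[≠] (0 : ℂ), H.eval (γ t).1 ≠ 0 := by
  have hc : Tendsto (fun t => (γ t).1) (𝓝[≠] 0) (𝓝 a) := by
    have := h.analyticAt_fst.continuousAt.tendsto
    rw [h.fst_zero] at this
    exact this.mono_left nhdsWithin_le_nhds
  have hf : ((H.roots.toFinset : Set ℂ) \ {a})ᶜ ∈ 𝓝 a :=
    (H.roots.toFinset.finite_toSet.subset Set.sdiff_subset).isClosed.isOpen_compl.mem_nhds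
      (by simp)
  filter_upwards [hc.eventually hf, h.eventually_fst_ne] with t h1 h2 h3
  exact h1 ⟨by simpa [hH] using h3, h2⟩

/-- The hyperelliptic involution; it carries parametrizations at `∞₊` to parametrizations at `∞₋`.
-/
theorem neg_snd (h : IsLocalParam E (a, b) γ) :
    IsLocalParam E (a, -b) (fun t => ((γ t).1, -(γ t).2)) where
  analyticAt := h.analyticAt_fst.prod h.analyticAt_snd.neg
  map_zero := by simp [h.map_zero]
  deriv_ne_zero := by
    rw [(h.hasDerivAt_fst.prodMk h.hasDerivAt_snd.fun_neg).deriv]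
    intro h0
    simp only [Prod.mk_eq_zero, neg_eq_zero] at h0
    exact h.deriv_fst_ne_zero_or.elim (· h0.1) (· h0.2)
  mem_curve := by filter_upwards [h.mem_curve] with t ht; simpa using ht

theorem meromorphicOrderAt_fst (h : IsLocalParam E (0, b) γ) (hb : b ≠ 0) :
    meromorphicOrderAt (fun t => (γ t).1) 0 = 1 := by
  rw [h.analyticAt_fst.meromorphicOrderAt_eq,
    h.analyticAt_fst.analyticOrderAt_eq_one_of_zero_deriv_ne_zero h.fst_zero
      (h.deriv_fst_ne_zero hb)]
  rfl

theorem meromorphicAt_eval_inv_fst (h : IsLocalParam E (a, b) γ) (P : ℂ[X]) :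
    MeromorphicAt (fun t => P.eval (1 / (γ t).1)) 0 := by
  simp only [eval_eq_sum]
  simp only [Polynomial.sum]
  have := h.analyticAt_fst.meromorphicAt
  fun_prop

theorem meromorphicOrderAt_eval_inv_fst (h : IsLocalParam E (0, b) γ) (hb : b ≠ 0) {P : ℂ[X]}
    (hP : P ≠ 0) :
    meromorphicOrderAt (fun t => P.eval (1 / (γ t).1)) 0 = ((-P.natDegree : ℤ) : WithTop ℤ) := by
  have hu := h.analyticAt_fst.meromorphicAt
  have h1 : (fun t => P.eval (1 / (γ t).1)) =ᶠ[𝓝[≠] 0]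
      (fun t => P.reverse.eval (γ t).1) * (fun t => (γ t).1) ^ (-P.natDegree : ℤ) := by
    filter_upwards [h.eventually_fst_ne] with t ht
    simp only [Pi.mul_apply, Pi.pow_apply, Pi.inv_apply, P.eval_reverse_eq ht, zpow_neg, zpow_natCast]
    field_simp
  have h2 := P.reverse.analyticAt_eval_comp h.analyticAt_fst
  have h3 : P.reverse.eval (γ 0).1 ≠ 0 := by
    rw [h.fst_zero, ← coeff_zero_eq_eval_zero, coeff_zero_reverse]
    exact leadingCoeff_ne_zero.2 hP
  have h4 : meromorphicOrderAt (fun t => P.reverse.eval (γ t).1) 0 = 0 := by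
    rw [h2.meromorphicOrderAt_eq, h2.analyticOrderAt_eq_zero.2 h3]
    rfl
  rw [meromorphicOrderAt_congr h1, meromorphicOrderAt_mul h2.meromorphicAt (hu.zpow _), h4,
    meromorphicOrderAt_zpow hu, h.meromorphicOrderAt_fst hb, zero_add, mul_one]

end IsLocalParam

/-- If `F = M * K` near a point, for a meromorphic function `M` of order `0` and analytic functions
`F` and `K`, then `F` and `K` have the same order. -/
theorem analyticOrderAt_eq_of_eventuallyEq_mul {F K M : ℂ → ℂ} {z : ℂ} (hF : AnalyticAt ℂ F z)
    (hK : AnalyticAt ℂ K z) (hM : MeromorphicAt M z) (hM0 : meromorphicOrderAt M z = 0)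
    (h : F =ᶠ[𝓝[≠] z] M * K) : analyticOrderAt F z = analyticOrderAt K z := by
  have h1 := meromorphicOrderAt_congr h
  rw [meromorphicOrderAt_mul hM hK.meromorphicAt, hM0, zero_add, hF.meromorphicOrderAt_eq,
    hK.meromorphicOrderAt_eq] at h1
  exact WithTop.map_injective Nat.cast_injective h1

theorem two_le_analyticOrderAt_iff {F : ℂ → ℂ} {z : ℂ} (hF : AnalyticAt ℂ F z) :
    2 ≤ analyticOrderAt F z ↔ F z = 0 ∧ deriv F z = 0 := by
  have := natCast_le_analyticOrderAt_iff_iteratedDeriv_eq_zero hF (n := 2)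
  rw [Nat.cast_ofNat] at this
  rw [this]
  constructor
  · intro h
    exact ⟨by simpa using h 0 (by norm_num), by simpa using h 1 (by norm_num)⟩
  · rintro ⟨h0, h1⟩ i hi
    interval_cases i
    · simpa using h0
    · simpa using h1

/-! ### Normal forms in the coordinate ring and values of rational functions -/

namespace HyperellipticCurve

variable (C : HyperellipticCurve)

theorem monic_equation : (X ^ 2 - Polynomial.C C.D : ℂ[X][Y]).Monic :=
  monic_X_pow_sub_C _ two_ne_zero

theorem natDegree_equation : (X ^ 2 - Polynomial.C C.D : ℂ[X][Y]).natDegree = 2 :=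
  natDegree_X_pow_sub_C

/-- The regular function `P(x) + y * Q(x)`. -/
noncomputable def regular (P Q : ℂ[X]) : C.CoordRing :=
  AdjoinRoot.mk _ (Polynomial.C Q * X + Polynomial.C P)

theorem exists_eq_regular (z : C.CoordRing) : ∃ P Q : ℂ[X], z = C.regular P Q := by
  obtain ⟨p, rfl⟩ := AdjoinRoot.mk_surjective z
  obtain ⟨Q, P, h⟩ := exists_eq_X_add_C_of_natDegree_le_one
    (p := p %ₘ (X ^ 2 - Polynomial.C C.D : ℂ[X][Y])) (by
      have := natDegree_modByMonic_lt p C.monic_equation (by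
        intro h
        have := C.natDegree_equation
        rw [h] at this
        simp at this)
      rw [C.natDegree_equation] at this
      omega)
  refine ⟨P, Q, ?_⟩
  rw [regular, ← h, AdjoinRoot.mk_eq_mk]
  exact ⟨_, sub_eq_of_eq_add' (modByMonic_add_div p _).symm⟩

theorem regular_one : C.regular 1 0 = 1 := by simp [regular]

theorem regular_mul (P Q R S : ℂ[X]) :
    C.regular P Q * C.regular R S = C.regular (P * R + C.D * (Q * S)) (P * S + Q * R) := by
  rw [regular, regular, regular, ← map_mul, AdjoinRoot.mk_eq_mk]
  refine ⟨Polynomial.C (Q * S), ?_⟩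
  simp only [map_add, map_mul]
  ring

theorem regular_eq_zero_iff {P Q : ℂ[X]} : C.regular P Q = 0 ↔ P = 0 ∧ Q = 0 := by
  constructor
  · intro h
    rw [regular, AdjoinRoot.mk_eq_zero] at h
    have h0 := eq_zero_of_dvd_of_degree_lt h (by
      rw [degree_eq_natDegree C.monic_equation.ne_zero, C.natDegree_equation]
      exact degree_linear_le.trans_lt (by norm_num))
    exact ⟨by simpa using congrArg (coeff · 0) h0, by simpa using congrArg (coeff · 1) h0⟩
  · rintro ⟨rfl, rfl⟩
    simp [regular]

theorem regular_mem_nonZeroDivisors {H : ℂ[X]} (hH : H ≠ 0) :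
    C.regular H 0 ∈ nonZeroDivisors C.CoordRing := by
  rw [mem_nonZeroDivisors_iff_right]
  intro z hz
  obtain ⟨P, Q, rfl⟩ := C.exists_eq_regular z
  rw [regular_mul, regular_eq_zero_iff] at hz
  rw [regular_eq_zero_iff]
  simpa [hH] using hz

variable {C} in
theorem evalEval_eq_of_mk_eq {p q : ℂ[X][Y]} {x y : ℂ} (hxy : y ^ 2 = C.D.eval x)
    (h : (AdjoinRoot.mk _ p : C.CoordRing) = AdjoinRoot.mk _ q) :
    p.evalEval x y = q.evalEval x y := by
  rw [AdjoinRoot.mk_eq_mk] at h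
  obtain ⟨r, hr⟩ := h
  have := congrArg (evalEval x y) hr
  rw [evalEval_mul, evalEval_sub, evalEval_sub, evalEval_pow, evalEval_X, evalEval_C, hxy, sub_self,
    zero_mul] at this
  exact sub_eq_zero.1 this

variable {C} in
-- Two fractions for `f` agree after cross-multiplication in the coordinate ring, so the choice made
-- in `value` is immaterial.
theorem value_eq {f : C.FunctionField} {G H : ℂ[X][Y]} (hf : C.IsFraction f G H) {x y : ℂ}
    (hxy : y ^ 2 = C.D.eval x) (hH : H.evalEval x y ≠ 0) :
    C.value f x y = G.evalEval x y / H.evalEval x y := by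
  have hex : ∃ GH : ℂ[X][Y] × ℂ[X][Y], C.IsFraction f GH.1 GH.2 ∧ GH.2.evalEval x y ≠ 0 :=
    ⟨(G, H), hf, hH⟩
  rw [value, dif_pos hex]
  obtain ⟨h1, h2⟩ := hex.choose_spec
  rw [div_eq_div_iff h2 hH, ← evalEval_mul, ← evalEval_mul]
  refine evalEval_eq_of_mk_eq hxy (IsFractionRing.injective C.CoordRing C.FunctionField ?_)
  rw [map_mul, map_mul, map_mul, map_mul, ← h1.2, ← hf.2]
  ring

variable {C} in
theorem value_eq_of_mul_eq {f : C.FunctionField} {A B H : ℂ[X]}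
    (hf : f * algebraMap C.CoordRing C.FunctionField (C.regular H 0) =
      algebraMap C.CoordRing C.FunctionField (C.regular A B)) {x y : ℂ}
    (hxy : y ^ 2 = C.D.eval x) (hH : H.eval x ≠ 0) :
    C.value f x y = (A.eval x + y * B.eval x) / H.eval x := by
  have h0 : H ≠ 0 := by rintro rfl; simp at hH
  rw [value_eq (G := Polynomial.C B * X + Polynomial.C A) (H := Polynomial.C 0 * X + Polynomial.C H)
    ⟨C.regular_mem_nonZeroDivisors h0, hf⟩ hxy]
  · simp only [evalEval_add, evalEval_mul, evalEval_C, evalEval_X, eval_zero, zero_mul, zero_add]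
    ring
  · simpa [evalEval_add, evalEval_mul, evalEval_C] using hH

theorem value_regular (A B : ℂ[X]) {x y : ℂ} (hxy : y ^ 2 = C.D.eval x) :
    C.value (algebraMap C.CoordRing C.FunctionField (C.regular A B)) x y =
      A.eval x + y * B.eval x := by
  rw [value_eq_of_mul_eq (A := A) (B := B) (H := 1) _ hxy (by simp)]
  · simp
  · rw [← map_mul, regular_mul]
    simp

/-- Rationalize the denominator: multiplying by the conjugate of `P + y Q` replaces it by its norm,
a polynomial in `x` alone. -/
theorem exists_mul_eq (f : C.FunctionField) : ∃ A B H : ℂ[X], H ≠ 0 ∧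
    f * algebraMap C.CoordRing C.FunctionField (C.regular H 0) =
      algebraMap C.CoordRing C.FunctionField (C.regular A B) := by
  obtain ⟨n, d, rfl⟩ := IsLocalization.exists_mk'_eq (nonZeroDivisors C.CoordRing) f
  obtain ⟨d, hd⟩ := d
  obtain ⟨P, Q, rfl⟩ := C.exists_eq_regular d
  obtain ⟨A, B, h⟩ := C.exists_eq_regular (n * C.regular P (-Q))
  have hN : C.regular P Q * C.regular P (-Q) = C.regular (P ^ 2 - C.D * Q ^ 2) 0 := by
    rw [regular_mul]
    congr 1 <;> ring
  refine ⟨A, B, P ^ 2 - C.D * Q ^ 2, ?_, ?_⟩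
  -- A zero norm means that the non-zero-divisor `P + y Q` kills its conjugate, so `P = Q = 0`; but
  -- `0` is not a non-zero-divisor here.
  · intro h0
    rw [h0, C.regular_eq_zero_iff.2 ⟨rfl, rfl⟩, mul_comm] at hN
    have h1 := (mem_nonZeroDivisors_iff_right.1 hd) _ hN
    rw [regular_eq_zero_iff, neg_eq_zero] at h1
    rw [C.regular_eq_zero_iff.2 h1] at hd
    have h2 : C.regular 1 0 = 0 := mem_nonZeroDivisors_iff_right.1 hd _ (mul_zero _)
    exact one_ne_zero (C.regular_eq_zero_iff.1 h2).1
  · rw [← h, ← hN, map_mul, map_mul, ← mul_assoc]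
    congr 1
    exact IsLocalization.mk'_spec _ n ⟨_, hd⟩

end HyperellipticCurve

namespace HyperellipticCurve

variable (C : HyperellipticCurve)

theorem eval_derivative_ne_zero {a : ℂ} (ha : C.D.eval a = 0) : C.D.derivative.eval a ≠ 0 := by
  intro hc
  have h1 := (one_lt_rootMultiplicity_iff_isRoot C.monic.ne_zero).2 ⟨ha, hc⟩
  have h2 := Multiset.nodup_iff_count_le_one.1 C.nodup_roots a
  rw [count_roots] at h2
  omega

/-! ### Zeros and poles on the affine curve -/

section Affine

variable {C}

theorem pullback_affine_eventuallyEq {f : C.FunctionField} {A B H : ℂ[X]} (hH : H ≠ 0)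
    (hf : f * algebraMap C.CoordRing C.FunctionField (C.regular H 0) =
      algebraMap C.CoordRing C.FunctionField (C.regular A B)) {a b : ℂ}
    (hab : b ^ 2 = C.D.eval a) {γ : ℂ → ℂ × ℂ} (hγ : IsLocalParam C.D (a, b) γ) :
    C.pullback f (.affine a b hab) γ =ᶠ[𝓝[≠] 0]
      fun t => (A.eval (γ t).1 + (γ t).2 * B.eval (γ t).1) / H.eval (γ t).1 := by
  filter_upwards [hγ.eventually_eval_fst_ne_zero hH, hγ.mem_curve.filter_mono nhdsWithin_le_nhds]
    with t h1 h2 using value_eq_of_mul_eq hf h2 h1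

theorem analyticAt_regular {E : ℂ[X]} {a b : ℂ} {γ : ℂ → ℂ × ℂ} (hγ : IsLocalParam E (a, b) γ)
    (A B : ℂ[X]) : AnalyticAt ℂ (fun t => A.eval (γ t).1 + (γ t).2 * B.eval (γ t).1) 0 :=
  (A.analyticAt_eval_comp hγ.analyticAt_fst).add
    (hγ.analyticAt_snd.mul (B.analyticAt_eval_comp hγ.analyticAt_fst))

theorem analyticOrderAt_numerator_eq {f : C.FunctionField} {A B H : ℂ[X]} (hH : H ≠ 0)
    (hf : f * algebraMap C.CoordRing C.FunctionField (C.regular H 0) =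
      algebraMap C.CoordRing C.FunctionField (C.regular A B)) {a b : ℂ}
    (hab : b ^ 2 = C.D.eval a) (h0 : C.HasOrder f (.affine a b hab) 0) {γ : ℂ → ℂ × ℂ}
    (hγ : IsLocalParam C.D (a, b) γ) :
    analyticOrderAt (fun t => A.eval (γ t).1 + (γ t).2 * B.eval (γ t).1) 0 =
      analyticOrderAt (fun t => H.eval (γ t).1) 0 := by
  refine analyticOrderAt_eq_of_eventuallyEq_mul (analyticAt_regular hγ A B)
    (H.analyticAt_eval_comp hγ.analyticAt_fst) (h0 γ hγ).1 (h0 γ hγ).2 ?_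
  filter_upwards [pullback_affine_eventuallyEq hH hf hab hγ, hγ.eventually_eval_fst_ne_zero hH]
    with t h1 h2
  rw [Pi.mul_apply, h1, div_mul_cancel₀ _ h2]

theorem eval_numerator_eq_zero {f : C.FunctionField} {A B H : ℂ[X]} (hH : H ≠ 0)
    (hf : f * algebraMap C.CoordRing C.FunctionField (C.regular H 0) =
      algebraMap C.CoordRing C.FunctionField (C.regular A B)) {a b : ℂ}
    (hab : b ^ 2 = C.D.eval a) (h0 : C.HasOrder f (.affine a b hab) 0) (ha : H.eval a = 0) :
    A.eval a + b * B.eval a = 0 := by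
  obtain ⟨γ, hγ⟩ := C.exists_isParamAt (.affine a b hab)
  have h1 := analyticOrderAt_numerator_eq hH hf hab h0 hγ
  have h2 : analyticOrderAt (fun t => H.eval (γ t).1) 0 ≠ 0 :=
    (H.analyticAt_eval_comp hγ.analyticAt_fst).analyticOrderAt_ne_zero.2 (by
      rw [hγ.fst_zero, ha])
  rw [← h1] at h2
  simpa [hγ.map_zero] using apply_eq_zero_of_analyticOrderAt_ne_zero h2

/-- The numerator vanishes wherever `H` does, to the same order. Over an unbranched `a`, both `A(a)
+ b B(a)` and `A(a) - b B(a)` vanish. At a branch point `x` is ramified, so `H` vanishes to order at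
least `2`; the derivative of the numerator there is `y' B(a)` with `y' ≠ 0`. -/
theorem eval_eq_zero_of_hasOrder {f : C.FunctionField} {A B H : ℂ[X]} (hH : H ≠ 0)
    (hf : f * algebraMap C.CoordRing C.FunctionField (C.regular H 0) =
      algebraMap C.CoordRing C.FunctionField (C.regular A B))
    (h0 : ∀ a b hab, C.HasOrder f (.affine a b hab) 0) {a : ℂ} (ha : H.eval a = 0) :
    A.eval a = 0 ∧ B.eval a = 0 := by
  obtain ⟨b, hab⟩ := IsAlgClosed.exists_pow_nat_eq (C.D.eval a) two_pos
  have h1 := eval_numerator_eq_zero hH hf hab (h0 _ _ _) ha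
  by_cases hb : b = 0
  · subst hb
    refine ⟨by simpa using h1, ?_⟩
    obtain ⟨γ, hγ⟩ := C.exists_isParamAt (.affine a 0 hab)
    have hγ : IsLocalParam C.D (a, 0) γ := hγ
    have hx := hγ.deriv_fst_eq_zero (C.eval_derivative_ne_zero (by simpa using hab.symm))
    have hy := hγ.deriv_fst_ne_zero_or.resolve_left (not_not.2 hx)
    have hxd := hγ.hasDerivAt_fst
    rw [hx] at hxd
    have h2 : 2 ≤ analyticOrderAt (fun t => H.eval (γ t).1) 0 := by
      rw [two_le_analyticOrderAt_iff (H.analyticAt_eval_comp hγ.analyticAt_fst)]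
      exact ⟨by rw [hγ.fst_zero, ha], by rw [(H.hasDerivAt_eval_comp hxd).deriv, mul_zero]⟩
    rw [← analyticOrderAt_numerator_eq hH hf hab (h0 _ _ _) hγ,
      two_le_analyticOrderAt_iff (analyticAt_regular hγ A B),
      ((A.hasDerivAt_eval_comp hxd).fun_add
        (hγ.hasDerivAt_snd.fun_mul (B.hasDerivAt_eval_comp hxd))).deriv] at h2
    simpa [hγ.map_zero, hy] using h2.2
  · have h2 := eval_numerator_eq_zero hH hf (b := -b) (by rw [neg_sq, hab]) (h0 _ _ _) ha
    have h3 : A.eval a = 0 := by linear_combination (h1 + h2) / 2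
    refine ⟨h3, ?_⟩
    rw [h3, zero_add, mul_eq_zero] at h1
    exact h1.resolve_left hb

/-- A rational function without zeros and poles on the affine curve is regular there. -/
theorem exists_eq_regular_of_hasOrder {f : C.FunctionField}
    (h0 : ∀ a b hab, C.HasOrder f (.affine a b hab) 0) :
    ∃ P Q : ℂ[X], f = algebraMap C.CoordRing C.FunctionField (C.regular P Q) := by
  -- Induction on the degree of the denominator: each root `a` of `H` is a common root of `A` and
  -- `B`, so `x - a` cancels.
  suffices ∀ n : ℕ, ∀ A B H : ℂ[X], H.natDegree = n → H ≠ 0 →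
      f * algebraMap C.CoordRing C.FunctionField (C.regular H 0) =
        algebraMap C.CoordRing C.FunctionField (C.regular A B) →
      ∃ P Q : ℂ[X], f = algebraMap C.CoordRing C.FunctionField (C.regular P Q) by
    obtain ⟨A, B, H, hH, hf⟩ := C.exists_mul_eq f
    exact this _ A B H rfl hH hf
  intro n
  induction n with
  | zero =>
    intro A B H hn hH hf
    obtain ⟨c, rfl⟩ := natDegree_eq_zero.1 hn
    have hc : c ≠ 0 := by rintro rfl; simp at hH
    refine ⟨A * Polynomial.C c⁻¹, B * Polynomial.C c⁻¹, ?_⟩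
    have h1 : C.regular (A * Polynomial.C c⁻¹) (B * Polynomial.C c⁻¹) =
        C.regular A B * C.regular (Polynomial.C c⁻¹) 0 := by simp [regular_mul]
    have h2 : C.regular (Polynomial.C c) 0 * C.regular (Polynomial.C c⁻¹) 0 = 1 := by
      rw [regular_mul, mul_zero, mul_zero, mul_zero, zero_mul, add_zero, add_zero,
        ← Polynomial.C_mul, mul_inv_cancel₀ hc, Polynomial.C_1, regular_one]
    rw [h1, map_mul, ← hf, mul_assoc, ← map_mul, h2, map_one, mul_one]
  | succ n ih =>
    intro A B H hn hH hf
    obtain ⟨a, ha⟩ := IsAlgClosed.exists_root H (fun h => by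
      have := natDegree_eq_zero_iff_degree_le_zero.2 h.le
      omega)
    obtain ⟨hA, hB⟩ := eval_eq_zero_of_hasOrder hH hf h0 ha
    obtain ⟨H, rfl⟩ := dvd_iff_isRoot.2 ha
    obtain ⟨A, rfl⟩ := dvd_iff_isRoot.2 hA
    obtain ⟨B, rfl⟩ := dvd_iff_isRoot.2 hB
    have hH' : H ≠ 0 := right_ne_zero_of_mul hH
    rw [natDegree_mul (X_sub_C_ne_zero a) hH', natDegree_X_sub_C] at hn
    refine ih A B H (by omega) hH' ?_
    have h1 : ∀ P Q : ℂ[X], C.regular ((X - Polynomial.C a) * P) ((X - Polynomial.C a) * Q) =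
        C.regular P Q * C.regular (X - Polynomial.C a) 0 := by
      intro P Q
      rw [regular_mul]
      congr 1 <;> ring
    have h2 := h1 H 0
    rw [mul_zero] at h2
    rw [h1, h2, map_mul, map_mul, ← mul_assoc] at hf
    exact (IsLocalization.map_units C.FunctionField
      ⟨_, C.regular_mem_nonZeroDivisors (X_sub_C_ne_zero a)⟩).mul_right_cancel hf

theorem hasOrder_zero_iff {P Q : ℂ[X]} {a b : ℂ} (hab : b ^ 2 = C.D.eval a) :
    C.HasOrder (algebraMap C.CoordRing C.FunctionField (C.regular P Q)) (.affine a b hab) 0 ↔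
      P.eval a + b * Q.eval a ≠ 0 := by
  have key : ∀ γ, IsLocalParam C.D (a, b) γ →
      ((MeromorphicAt (C.pullback (algebraMap C.CoordRing C.FunctionField (C.regular P Q))
        (.affine a b hab) γ) 0 ∧ meromorphicOrderAt (C.pullback
        (algebraMap C.CoordRing C.FunctionField (C.regular P Q)) (.affine a b hab) γ) 0 =
          ((0 : ℤ) : WithTop ℤ)) ↔ P.eval a + b * Q.eval a ≠ 0) := by
    intro γ hγ
    have h1 := (pullback_affine_eventuallyEq (A := P) (B := Q) (H := 1) one_ne_zero
      (f := algebraMap C.CoordRing C.FunctionField (C.regular P Q))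
      (by rw [← map_mul, regular_mul]; simp) hab hγ)
    simp only [eval_one, div_one] at h1
    have h2 := analyticAt_regular hγ P Q
    rw [MeromorphicAt.meromorphicAt_congr h1, meromorphicOrderAt_congr h1,
      and_iff_right h2.meromorphicAt, h2.meromorphicOrderAt_eq]
    have h3 := h2.analyticOrderAt_eq_zero
    rw [hγ.map_zero] at h3
    rw [← h3]
    exact (WithTop.map_injective Nat.cast_injective).eq_iff (b := (0 : ℕ∞))
  constructor
  · intro h
    obtain ⟨γ, hγ⟩ := C.exists_isParamAt (.affine a b hab)
    exact (key γ hγ).1 (h γ hγ)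
  · exact fun h γ hγ => (key γ hγ).2 h

/-- A regular function without zeros on the affine curve has a constant norm. -/
theorem isPellAbelSolution_of_eval_ne_zero {P Q : ℂ[X]}
    (h : ∀ a b : ℂ, b ^ 2 = C.D.eval a → P.eval a + b * Q.eval a ≠ 0) :
    C.IsPellAbelSolution P Q := by
  -- The norm at `a` is the product of the values at the points `(a, b)` and `(a, -b)`.
  have h1 : ∀ a, (P ^ 2 - C.D * Q ^ 2).eval a ≠ 0 := by
    intro a
    obtain ⟨b, hab⟩ := IsAlgClosed.exists_pow_nat_eq (C.D.eval a) two_pos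
    have := mul_ne_zero (h a b hab) (h a (-b) (by rw [neg_sq, hab]))
    convert this using 1
    rw [eval_sub, eval_mul, eval_pow, eval_pow, ← hab]
    ring
  have h2 : (P ^ 2 - C.D * Q ^ 2).degree = 0 := by
    by_contra hd
    obtain ⟨a, ha⟩ := IsAlgClosed.exists_root _ hd
    exact h1 a ha
  have h3 := eq_C_of_degree_eq_zero h2
  refine ⟨_, fun hc => h1 0 ?_, h3⟩
  rw [h3, hc]
  simp

end Affine

/-! ### Expansions at infinity -/

section Infinity

variable {C}

/-- The regular function `P(x) + y * Q(x)` in the coordinates `(u, v)` at infinity. -/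
noncomputable def atInfinity (n : ℕ) (P Q : ℂ[X]) (w : ℂ × ℂ) : ℂ :=
  P.eval (1 / w.1) + w.2 / w.1 ^ n * Q.eval (1 / w.1)

theorem sq_eq_of_sq_eq_Dinf {u v : ℂ} (hu : u ≠ 0) (h : v ^ 2 = C.Dinf.eval u) :
    (v / u ^ (C.g + 1)) ^ 2 = C.D.eval (1 / u) := by
  rw [Dinf, C.D.eval_reverse_eq hu, C.natDegree_eq] at h
  rw [div_pow, h]
  field_simp
  ring

theorem pullback_infinity_eventuallyEq (P Q : ℂ[X]) {v : ℂ} (hv : v ^ 2 = C.Dinf.eval 0)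
    {γ : ℂ → ℂ × ℂ} (hγ : IsLocalParam C.Dinf (0, v) γ) :
    C.pullback (algebraMap C.CoordRing C.FunctionField (C.regular P Q)) (.infinity v hv) γ
      =ᶠ[𝓝[≠] 0] fun t => atInfinity (C.g + 1) P Q (γ t) := by
  filter_upwards [hγ.eventually_fst_ne, hγ.mem_curve.filter_mono nhdsWithin_le_nhds]
    with t h1 h2 using C.value_regular P Q (sq_eq_of_sq_eq_Dinf h1 h2)

theorem meromorphicAt_atInfinity {E : ℂ[X]} {a b : ℂ} {γ : ℂ → ℂ × ℂ}
    (hγ : IsLocalParam E (a, b) γ) (n : ℕ) (P Q : ℂ[X]) :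
    MeromorphicAt (fun t => atInfinity n P Q (γ t)) 0 :=
  (hγ.meromorphicAt_eval_inv_fst P).add ((hγ.analyticAt_snd.meromorphicAt.div
    (hγ.analyticAt_fst.meromorphicAt.pow n)).mul (hγ.meromorphicAt_eval_inv_fst Q))

/-- Factoring out `u ^ (-deg P)` leaves a combination of the reversed polynomials whose value at the
point is `hl`'s left side: the top terms do not cancel. -/
theorem meromorphicOrderAt_atInfinity {E : ℂ[X]} {v : ℂ} {γ : ℂ → ℂ × ℂ}
    (hγ : IsLocalParam E (0, v) γ) (hv : v ≠ 0) {n : ℕ} {P Q : ℂ[X]}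
    (hd : P.natDegree = Q.natDegree + n) (hl : P.leadingCoeff + v * Q.leadingCoeff ≠ 0) :
    meromorphicOrderAt (fun t => atInfinity n P Q (γ t)) 0 =
      ((-P.natDegree : ℤ) : WithTop ℤ) := by
  have hu := hγ.analyticAt_fst.meromorphicAt
  have h1 : (fun t => atInfinity n P Q (γ t)) =ᶠ[𝓝[≠] 0]
      (fun t => P.reverse.eval (γ t).1 + (γ t).2 * Q.reverse.eval (γ t).1) *
        (fun t => (γ t).1) ^ (-P.natDegree : ℤ) := by
    filter_upwards [hγ.eventually_fst_ne] with t ht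
    simp only [Pi.mul_apply, Pi.pow_apply, Pi.inv_apply, eval_reverse_eq _ ht, zpow_neg,
      zpow_natCast, atInfinity, hd, pow_add]
    field_simp
  have h2 := analyticAt_regular hγ P.reverse Q.reverse
  have h3 : P.reverse.eval (γ 0).1 + (γ 0).2 * Q.reverse.eval (γ 0).1 ≠ 0 := by
    rwa [hγ.map_zero, ← coeff_zero_eq_eval_zero, coeff_zero_reverse, ← coeff_zero_eq_eval_zero,
      coeff_zero_reverse]
  have h4 : meromorphicOrderAt
      (fun t => P.reverse.eval (γ t).1 + (γ t).2 * Q.reverse.eval (γ t).1) 0 = 0 := by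
    rw [h2.meromorphicOrderAt_eq, h2.analyticOrderAt_eq_zero.2 h3]
    rfl
  rw [meromorphicOrderAt_congr h1, meromorphicOrderAt_mul h2.meromorphicAt (hu.zpow _), h4,
    meromorphicOrderAt_zpow hu, hγ.meromorphicOrderAt_fst hv, zero_add, mul_one]

end Infinity

/-! ### Solutions of the Pell-Abel equation -/

section PellAbel

variable {C} {P Q : ℂ[X]}

theorem IsPellAbelSolution.neg (h : C.IsPellAbelSolution P Q) : C.IsPellAbelSolution P (-Q) := by
  simpa [IsPellAbelSolution] using h

theorem IsPellAbelSolution.ne_zero (h : C.IsPellAbelSolution P Q) : P ≠ 0 := by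
  rintro rfl
  obtain ⟨c, hc, h⟩ := h
  have hQ : Q ≠ 0 := by
    rintro rfl
    apply hc
    simpa using h.symm
  have h1 := congrArg natDegree h
  rw [zero_pow two_ne_zero, zero_sub, natDegree_neg, natDegree_C,
    natDegree_mul C.monic.ne_zero (pow_ne_zero 2 hQ), C.natDegree_eq] at h1
  omega

theorem IsPellAbelSolution.eq_zero_of_natDegree_eq_zero (h : C.IsPellAbelSolution P Q)
    (hP : P.natDegree = 0) : Q = 0 := by
  obtain ⟨p, rfl⟩ := natDegree_eq_zero.1 hP
  obtain ⟨c, hc, h⟩ := h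
  by_contra hQ
  have h0 : C.D * Q ^ 2 = Polynomial.C (p ^ 2 - c) := by
    rw [Polynomial.C_sub, ← h, Polynomial.C_pow]
    ring
  have h1 := congrArg natDegree h0
  rw [natDegree_C, natDegree_mul C.monic.ne_zero (pow_ne_zero 2 hQ), C.natDegree_eq] at h1
  omega

/-- Compare top terms in `P ^ 2 - c = D Q ^ 2`; since `P` is nonconstant, `c` does not affect them.
-/
theorem IsPellAbelSolution.natDegree_eq_and (h : C.IsPellAbelSolution P Q)
    (hP : P.natDegree ≠ 0) :
    P.natDegree = Q.natDegree + (C.g + 1) ∧ P.leadingCoeff ^ 2 = Q.leadingCoeff ^ 2 := by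
  obtain ⟨c, hc, h⟩ := h
  have h0 : P ^ 2 - Polynomial.C c = C.D * Q ^ 2 := by rw [← h]; ring
  have hd : (Polynomial.C c).degree < (P ^ 2).degree :=
    degree_lt_degree (by rw [natDegree_C, natDegree_pow]; omega)
  have h2 := congrArg leadingCoeff h0
  rw [leadingCoeff_sub_of_degree_lt hd, leadingCoeff_mul, C.monic.leadingCoeff, one_mul,
    leadingCoeff_pow, leadingCoeff_pow] at h2
  refine ⟨?_, h2⟩
  have hQ : Q ≠ 0 := by
    rintro rfl
    have : P = 0 := by simpa using h2
    simp [this] at hP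
  have h1 := congrArg natDegree h0
  rw [natDegree_sub_C, natDegree_mul C.monic.ne_zero (pow_ne_zero 2 hQ), C.natDegree_eq,
    natDegree_pow, natDegree_pow] at h1
  omega

/-- A solution of the Pell-Abel equation gives a unit of the ring of regular functions. -/
theorem IsPellAbelSolution.isUnit_regular (h : C.IsPellAbelSolution P Q) :
    IsUnit (C.regular P Q) := by
  obtain ⟨c, hc, h⟩ := h
  refine IsUnit.of_mul_eq_one (C.regular (Polynomial.C c⁻¹ * P) (-(Polynomial.C c⁻¹ * Q))) ?_
  have h1 : P * (Polynomial.C c⁻¹ * P) + C.D * (Q * -(Polynomial.C c⁻¹ * Q)) = 1 := by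
    calc _ = Polynomial.C c⁻¹ * (P ^ 2 - C.D * Q ^ 2) := by ring
      _ = 1 := by rw [h, ← Polynomial.C_mul, inv_mul_cancel₀ hc, Polynomial.C_1]
  have h2 : P * -(Polynomial.C c⁻¹ * Q) + Q * (Polynomial.C c⁻¹ * P) = 0 := by ring
  rw [regular_mul, h1, h2, regular_one]

theorem IsPellAbelSolution.eval_ne_zero (h : C.IsPellAbelSolution P Q) {a b : ℂ}
    (hab : b ^ 2 = C.D.eval a) : P.eval a + b * Q.eval a ≠ 0 := by
  obtain ⟨c, hc, h⟩ := h
  intro h0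
  have h1 := congrArg (eval a) h
  rw [eval_sub, eval_mul, eval_pow, eval_pow, ← hab, eval_C] at h1
  apply hc
  rw [← h1]
  linear_combination (P.eval a - b * Q.eval a) * h0

/-- The product of the function and its conjugate is the nonzero constant `c`. -/
theorem IsPellAbelSolution.order_add_order (h : C.IsPellAbelSolution P Q) {v : ℂ}
    {γ : ℂ → ℂ × ℂ} (hγ : IsLocalParam C.Dinf (0, v) γ) :
    meromorphicOrderAt (fun t => atInfinity (C.g + 1) P Q (γ t)) 0 +
      meromorphicOrderAt (fun t => atInfinity (C.g + 1) P (-Q) (γ t)) 0 = 0 := by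
  classical
  obtain ⟨c, hc, h⟩ := h
  rw [← meromorphicOrderAt_mul (meromorphicAt_atInfinity hγ _ _ _)
    (meromorphicAt_atInfinity hγ _ _ _)]
  have h1 : ((fun t => atInfinity (C.g + 1) P Q (γ t)) *
      fun t => atInfinity (C.g + 1) P (-Q) (γ t)) =ᶠ[𝓝[≠] 0] fun _ => c := by
    filter_upwards [hγ.eventually_fst_ne, hγ.mem_curve.filter_mono nhdsWithin_le_nhds]
      with t h1 h2
    have h3 := congrArg (eval (1 / (γ t).1)) h
    rw [eval_sub, eval_mul, eval_pow, eval_pow, ← sq_eq_of_sq_eq_Dinf h1 h2, eval_C] at h3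
    rw [← h3, Pi.mul_apply, atInfinity, atInfinity, eval_neg]
    ring
  rw [meromorphicOrderAt_congr h1, meromorphicOrderAt_const, if_neg hc]

theorem order_of_add_eq_zero {m n : WithTop ℤ} {k : ℤ} (h : m + n = 0)
    (hn : n = ((-k : ℤ) : WithTop ℤ)) : m = (k : WithTop ℤ) := by
  subst hn
  induction m using WithTop.recTopCoe with
  | top => simp at h
  | coe m =>
    have : m + -k = 0 := by exact_mod_cast h
    exact_mod_cast (by omega : m = k)

/-- The orders of `P(x) + y * Q(x)` at the points at infinity, for a solution of the Pell-Abel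
equation in which `P` and `Q` have the same leading coefficient. -/
theorem IsPellAbelSolution.order_atInfinity (h : C.IsPellAbelSolution P Q)
    (hl : P.natDegree ≠ 0 → P.leadingCoeff = Q.leadingCoeff) {v : ℂ} (hv : v = 1 ∨ v = -1)
    {γ : ℂ → ℂ × ℂ} (hγ : IsLocalParam C.Dinf (0, v) γ) :
    meromorphicOrderAt (fun t => atInfinity (C.g + 1) P Q (γ t)) 0 =
      ((if v = 1 then -P.natDegree else P.natDegree : ℤ) : WithTop ℤ) := by
  have hv0 : v ≠ 0 := by rcases hv with rfl | rfl <;> norm_num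
  by_cases hP : P.natDegree = 0
  · rw [h.eq_zero_of_natDegree_eq_zero hP]
    simp only [atInfinity, eval_zero, mul_zero, add_zero]
    rw [hγ.meromorphicOrderAt_eval_inv_fst hv0 h.ne_zero, hP]
    simp
  · have hd := (h.natDegree_eq_and hP).1
    have h2 : P.leadingCoeff + P.leadingCoeff ≠ 0 := by
      rw [← two_mul]
      exact mul_ne_zero two_ne_zero (leadingCoeff_ne_zero.2 h.ne_zero)
    rcases hv with rfl | rfl
    · rw [if_pos rfl]
      exact meromorphicOrderAt_atInfinity hγ hv0 hd (by rwa [one_mul, ← hl hP])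
    -- At `∞₋` the top terms of `P + y Q` cancel, but those of the conjugate add up, so the order
    -- comes from the conjugate's.
    · rw [if_neg (by norm_num)]
      refine order_of_add_eq_zero (h.order_add_order hγ) ?_
      exact meromorphicOrderAt_atInfinity hγ hv0 (by rwa [natDegree_neg])
        (by rwa [leadingCoeff_neg, neg_mul_neg, one_mul, ← hl hP])

/-- The sign of `Q` decides which point at infinity carries the pole. -/
theorem IsPellAbelSolution.exists_leadingCoeff_eq (h : C.IsPellAbelSolution P Q) :
    ∃ Q', C.IsPellAbelSolution P Q' ∧ (P.natDegree ≠ 0 → P.leadingCoeff = Q'.leadingCoeff) := by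
  by_cases hP : P.natDegree = 0
  · exact ⟨Q, h, fun h => absurd hP h⟩
  · rcases sq_eq_sq_iff_eq_or_eq_neg.1 (h.natDegree_eq_and hP).2 with h1 | h1
    · exact ⟨Q, h, fun _ => h1⟩
    · exact ⟨-Q, h.neg, fun _ => by rw [leadingCoeff_neg, h1]⟩

/-- The degree of `P` is the order of the pole of `P(x) + y * Q(x)` at `∞₊`, if the order of the
zero at `∞₋` is the same. -/
theorem IsPellAbelSolution.natDegree_eq_of_order (h : C.IsPellAbelSolution P Q) {r : ℕ}
    {γ : ℂ → ℂ × ℂ} (hγ : IsLocalParam C.Dinf (0, 1) γ)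
    (h1 : meromorphicOrderAt (fun t => atInfinity (C.g + 1) P Q (γ t)) 0 =
      ((-r : ℤ) : WithTop ℤ))
    (h2 : meromorphicOrderAt (fun t => atInfinity (C.g + 1) P Q ((γ t).1, -(γ t).2)) 0 =
      ((r : ℤ) : WithTop ℤ)) : P.natDegree = r := by
  have hm1 := meromorphicAt_atInfinity hγ (C.g + 1) P Q
  have hm2 := meromorphicAt_atInfinity hγ.neg_snd (C.g + 1) P Q
  -- Adding the image under the involution removes `y` and leaves `2 P(1 / u)`, of order `-deg P`.
  have hs : ((fun t => atInfinity (C.g + 1) P Q (γ t)) +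
      fun t => atInfinity (C.g + 1) P Q ((γ t).1, -(γ t).2)) =
      fun t => (Polynomial.C 2 * P).eval (1 / (γ t).1) := by
    ext t
    simp only [Pi.add_apply, atInfinity, eval_mul, eval_C]
    ring
  have h3 := hγ.meromorphicOrderAt_eval_inv_fst one_ne_zero
    (mul_ne_zero (C_ne_zero.2 two_ne_zero) h.ne_zero)
  rw [← hs, natDegree_C_mul two_ne_zero] at h3
  -- For `r = 0` both summands have order `0` and may cancel, but the bound `-deg P ≥ 0` suffices.
  -- For `r > 0` the orders differ and the pole dominates.
  rcases Nat.eq_zero_or_pos r with rfl | hr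
  · have h4 := meromorphicOrderAt_add hm1 hm2
    rw [h1, h2, h3, Nat.cast_zero, neg_zero, min_self] at h4
    have : (0 : ℤ) ≤ -P.natDegree := by exact_mod_cast h4
    omega
  · rw [meromorphicOrderAt_add_eq_left_of_lt hm2 (by
      rw [h1, h2]
      exact_mod_cast (by omega : (-r : ℤ) < r)), h1] at h3
    have : (-r : ℤ) = -P.natDegree := by exact_mod_cast h3
    omega

end PellAbel

/-! ### Coefficients of the divisor and the equivalence -/

section Divisor

theorem infinity_eq_one_or {v : ℂ} (hv : v ^ 2 = C.Dinf.eval 0) : v = 1 ∨ v = -1 := by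
  rwa [C.eval_zero_Dinf, _root_.sq_eq_one_iff] at hv

theorem smul_inftyDivisor_affine (r : ℤ) (a b : ℂ) (hab : b ^ 2 = C.D.eval a) :
    (r • C.inftyDivisor - 0) (.affine a b hab) = 0 := by
  simp [inftyDivisor, inftyPlus, inftyMinus]

theorem smul_inftyDivisor_infinity (r : ℤ) {v : ℂ} (hv : v ^ 2 = C.Dinf.eval 0) :
    (r • C.inftyDivisor - 0) (.infinity v hv) = if v = 1 then -r else r := by
  have h1 : (-1 : ℂ) ≠ 1 := by norm_num
  rcases C.infinity_eq_one_or hv with rfl | rfl <;>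
    simp [inftyDivisor, inftyPlus, inftyMinus, h1, h1.symm]

end Divisor

end HyperellipticCurve

open HyperellipticCurve in
theorem theorem4 (C : HyperellipticCurve) (r : ℕ) :
    (∃ P Q : Polynomial ℂ, C.IsPellAbelSolution P Q ∧ P.degree = (r : WithBot ℕ)) ↔
      C.LinearlyEquivalent ((r : ℤ) • C.inftyDivisor) 0 := by
  constructor
  · rintro ⟨P, Q₀, h₀, hP⟩
    obtain ⟨Q, h, hl⟩ := h₀.exists_leadingCoeff_eq
    have hr := natDegree_eq_of_degree_eq_some hP
    refine ⟨(h.isUnit_regular.map (algebraMap C.CoordRing C.FunctionField)).unit, ?_⟩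
    rw [IsUnit.unit_spec]
    rintro (⟨a, b, hab⟩ | ⟨v, hv⟩)
    · rw [smul_inftyDivisor_affine]
      exact (hasOrder_zero_iff hab).2 (h.eval_ne_zero hab)
    · intro γ hγ
      rw [smul_inftyDivisor_infinity, ← hr]
      have h1 := pullback_infinity_eventuallyEq P Q hv hγ
      rw [MeromorphicAt.meromorphicAt_congr h1, meromorphicOrderAt_congr h1]
      exact ⟨meromorphicAt_atInfinity hγ _ P Q,
        h.order_atInfinity hl (C.infinity_eq_one_or hv) hγ⟩
  · rintro ⟨f, hf⟩
    have hf0 : ∀ a b hab, C.HasOrder (f : C.FunctionField) (.affine a b hab) 0 := by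
      intro a b hab
      rw [← smul_inftyDivisor_affine C r a b hab]
      exact hf _
    obtain ⟨P, Q, hPQ⟩ := exists_eq_regular_of_hasOrder hf0
    rw [hPQ] at hf hf0
    have h : C.IsPellAbelSolution P Q := isPellAbelSolution_of_eval_ne_zero fun a b hab =>
      (hasOrder_zero_iff hab).1 (hf0 a b hab)
    have key : ∀ v (hv : v ^ 2 = C.Dinf.eval 0) γ, IsLocalParam C.Dinf (0, v) γ →
        meromorphicOrderAt (fun t => atInfinity (C.g + 1) P Q (γ t)) 0 =
          ((if v = 1 then -r else r : ℤ) : WithTop ℤ) := by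
      intro v hv γ hγ
      rw [← smul_inftyDivisor_infinity C r hv, ← (hf (.infinity v hv) γ hγ).2]
      exact (meromorphicOrderAt_congr (pullback_infinity_eventuallyEq P Q hv hγ)).symm
    obtain ⟨γ, hγ⟩ := C.exists_isParamAt C.inftyPlus
    have hγ : IsLocalParam C.Dinf (0, 1) γ := hγ
    refine ⟨P, Q, h, ?_⟩
    rw [degree_eq_natDegree h.ne_zero, h.natDegree_eq_of_order hγ (r := r)]
    · simpa using key 1 (by simp [C.eval_zero_Dinf]) γ hγ
    · have h1 : (-1 : ℂ) ≠ 1 := by norm_num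
      -- The order at `∞₋` is read in the involution's image of the same `γ`, so that both
      -- expansions can be added.
      simpa [h1] using key (-1) (by simp [C.eval_zero_Dinf]) _ hγ.neg_snd
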